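/- **Setting.** Let $\Sigma=\{P_1,\dots,P_s\}$ be a system of $s$ differential equations $P_i=0$ in the variables $x_1,\dots,x_n$: each $P_i$ is an analytic function of finitely many of the jet coordinates $t,\ x_j^{(k)}$, on a connected open set $U$ of the jet space $\mathbf J(\mathbb R,\mathbb R^n)$ (with the product topology). Let $A=(a_{i,j})$ be its order matrix, $a_{i,j}=\mathrm{ord}_{x_j}P_i\in\mathbb N\cup\{-\infty\}$, with $a_{i,j}=-\infty$ if neither $x_j$ nor any of its derivatives appears in $P_i$. For a matrix $M$ with entries in $\mathbb N\cup\{-\infty\}$, the Jacobi number $\mathcal O_M$ is the maximum over injections $\sigma$ from rows to columns of $\sum_i m_{i,\sigma(i)}$ ($-\infty$ if there is no injection). For a set $Y$ of $s$ variables, $\mathcal O_{Y,\Sigma}$ is the Jacobi number of the columns $Y$ of $A$. The saddle Jacobi number $\hat{\mathcal O}_\Sigma$ is the minimum of the $\mathcal O_{Y,\Sigma}\ne-\infty$ ($-\infty$ if there are none). $\Sigma$ is an ō-system if $\hat{\mathcal O}_\Sigma=0$. A canon of the square matrix $A_Y$ formed by the columns $Y$ of $A$ is a vector $\ell\in\mathbb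 N^s$ such that, after adding $\ell_i$ to every row $i$, there are $s$ entries in different rows and columns each of which is maximal in its column. Let $\lambda$ be the minimal canon, put $\alpha_i=\max_k\lambda_k-\lambda_i$ and $\beta_j=\max_i(a_{i,j}-\alpha_i)$ for $j\in Y$, and let $\nabla_{Y,\Sigma}=\det\big(\partial P_i/\partial x_j^{(\alpha_i+\beta_j)}\big)_{1\le i\le s,\ j\in Y}$ (an entry is $0$ if $\alpha_i+\beta_j<0$). An ō-system is ō-regular at $\eta\in U$ if there is a set $Y$ of $s$ variables with $\mathcal O_{Y,\Sigma}=\hat{\mathcal O}_\Sigma$ and $\nabla_{Y,\Sigma}(\eta)\neq0$. **Blocks of an ō-system.** Start with all rows of $A$ and repeat the following step until no row remains, say $p$ steps in all. Let $B$ be the submatrix of the remaining rows and of those columns whose entries in these rows are all $0$ or $-\infty$ and not all $-\infty$. Let $r$ be the maximal number of zeros of $B$ in mutually different rows and columns. Among the pairs (set of rows, set of columns) of $B$ of total cardinality $r$ that together contain all zeros of $B$, let $(R_0,C_0)$ be the one with $R_0$ maximal and $C_0$ minimal for inclusion. Remove the rows $R_0$. For $1\le h\le p$, let $\Sigma_h$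 be the set of equations in $R_0$, and $\Xi_h$ the set of variables in the columns of $B$ not in $C_0$, at step $p-h+1$. **Dense order $1$ block triangular systems.** $\Sigma$ is order $1$ block triangular if there are partitions $\Sigma=\bigcup_{h=1}^{q}\Sigma'_h$ and $\{x_1,\dots,x_n\}=\bigcup_{h=0}^{q}\Xi'_h$ such that the equations of $\Sigma'_h$ depend only on the variables of $\bigcup_{k\le h}\Xi'_k$ and have order at most $1$ in those of $\Xi'_{h-1}$ and at most $0$ in all others, and such that, for $1\le h\le q$, $\sharp\Xi'_{h-1}=\sharp\Sigma'_h$, $\mathcal O_{\Xi'_{h-1},\Sigma'_h}=\sharp\Xi'_{h-1}$ and $\mathcal O_{\Xi'_h,\Sigma'_h}=0$, these being the Jacobi numbers of the corresponding submatrices of $A$. It is dense if moreover $a_{i,j}=0$ for all $1\le h\le q$, $P_i\in\Sigma'_h$, $x_j\in\Xi'_h$. **Statement.** Let $\Sigma$ be an ō-system, with blocks $\Sigma_h,\Xi_h$, $1\le h\le p$, as above, and let $\eta\in U$. Assume that a) $\Sigma$ is a dense order $1$ block triangular system, or that b) for all $1\le h\le p$ and all $\Sigma'\subset\Sigma_h$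 with $\sharp\Sigma'=\sharp\Sigma_h-1$, the Jacobian matrix $\left(\frac{\partial P}{\partial x}(\eta)\ \middle|\ P\in\Sigma',\ x\in\Xi_h\right)$ has rank $\sharp\Sigma_h-1$. Then $\Sigma$ is ō-regular at $\eta$ if and only if, for all $1\le h\le p$, $$\mathrm{rank}\left(\frac{\partial P}{\partial x}(\eta)\ \middle|\ P\in\Sigma_h,\ x\in\Xi_h\right)=\sharp\Sigma_h .$$ -/

import Mathlib

/-- Points of the jet space `J(ℝ, ℝⁿ)`, with coordinates `t` and `x_j^{(k)}`, and with the product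
topology (the coarsest one for which all coordinates are continuous). -/
abbrev Jet (n : ℕ) : Type := ℝ × (Fin n → ℕ → ℝ)

/-- The projection of the jet space on the coordinates `t` and `x_j^{(k)}`, `k ≤ r`. -/
def Jet.trunc {n : ℕ} (r : ℕ) (ξ : Jet n) : ℝ × (Fin n → Fin (r + 1) → ℝ) :=
  (ξ.1, fun j k => ξ.2 j k)

/-- `P` is, on `U`, an analytic function of finitely many coordinates. -/
def IsAnalyticJetFunction {n : ℕ} (U : Set (Jet n)) (P : Jet n → ℝ) : Prop :=
  ∃ (r : ℕ) (f : ℝ × (Fin n → Fin (r + 1) → ℝ) → ℝ),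
    AnalyticOnNhd ℝ f (Jet.trunc r '' U) ∧ ∀ ξ ∈ U, P ξ = f (Jet.trunc r ξ)

/-- The partial derivative `∂P/∂x_j^{(k)}` at `ξ`. -/
noncomputable def jetPartial {n : ℕ} (P : Jet n → ℝ) (j : Fin n) (k : ℕ) (ξ : Jet n) : ℝ :=
  deriv (fun z : ℝ => P (ξ.1, Function.update ξ.2 j (Function.update (ξ.2 j) k z))) (ξ.2 j k)

open Classical in
/-- `ord_{x_j} P` on `U`: the greatest `k` such that `x_j^{(k)}` appears in `P`, and `-∞` (that is
`⊥`) if neither `x_j` nor any of its derivatives appears in `P`. -/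
noncomputable def jetOrder {n : ℕ} (U : Set (Jet n)) (P : Jet n → ℝ) (j : Fin n) : WithBot ℕ :=
  if ∃ k, ∃ ξ ∈ U, jetPartial P j k ξ ≠ 0 then
    ((sSup {k : ℕ | ∃ ξ ∈ U, jetPartial P j k ξ ≠ 0} : ℕ) : WithBot ℕ)
  else ⊥

/-! ### Jacobi numbers, canons and covers of matrices with entries in `ℕ ∪ {-∞}` -/

/-- The Jacobi number: the maximum over all injections `σ` of rows into columns of
`∑ i, A i (σ i)`, and `-∞` if there is no injection. -/
noncomputable def jacobiNumber {ι κ : Type*} [Fintype ι] [Fintype κ]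
    (A : Matrix ι κ (WithBot ℕ)) : WithBot ℕ :=
  open Classical in Finset.univ.sup (fun σ : ι ↪ κ => ∑ i, A i (σ i))

/-- The submatrix on the rows `R` and the columns `C`. -/
def subBlock {ι κ α : Type*} (A : Matrix ι κ α) (R : Finset ι) (C : Finset κ) :
    Matrix R C α :=
  A.submatrix Subtype.val Subtype.val

/-- The square submatrix on all rows and on an `s`-element set `Y` of columns, the columns being
listed in increasing order. -/
def colBlock {s n : ℕ} {α : Type*} (A : Matrix (Fin s) (Fin n) α) (Y : Finset (Fin n))
    (hY : Y.card = s) : Matrix (Fin s) (Fin s) α :=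
  A.submatrix id (Y.orderEmbOfFin hY)

/-- `ℓ` is a canon of `A`: after adding `ℓ i` to every row `i`, there is a transversal family
(given by `σ`) of entries each of which is maximal in its column. -/
def IsCanon {ι κ : Type*} (A : Matrix ι κ (WithBot ℕ)) (l : ι → ℕ) : Prop :=
  ∃ σ : ι ↪ κ, ∀ i i', A i' (σ i) + (l i' : WithBot ℕ) ≤ A i (σ i) + (l i : WithBot ℕ)

/-- `l` is the minimal canon of `A`. -/
def IsMinimalCanon {ι κ : Type*} (A : Matrix ι κ (WithBot ℕ)) (l : ι → ℕ) : Prop :=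
  IsLeast {l' : ι → ℕ | IsCanon A l'} l

/-- The row part `α_i = max_k l_k - l_i` of the cover associated to a canon `l`. -/
def coverRow {ι : Type*} [Fintype ι] (l : ι → ℕ) (i : ι) : ℕ :=
  Finset.univ.sup l - l i

/-- The column part `β_j = max_i (A i j - α_i)` of the cover associated to a canon `l`. -/
noncomputable def coverCol {ι κ : Type*} [Fintype ι] (A : Matrix ι κ (WithBot ℕ)) (l : ι → ℕ)
    (j : κ) : WithBot ℤ :=
  Finset.univ.sup (fun i => (A i j).map (fun a : ℕ => (a : ℤ) - (coverRow l i : ℤ)))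

open Classical in
/-- The saddle Jacobi number: the minimum of the Jacobi numbers different from `-∞` of the square
submatrices obtained by choosing `s` columns, and `-∞` if there is no such submatrix. -/
noncomputable def saddleJacobiNumber {s n : ℕ} (A : Matrix (Fin s) (Fin n) (WithBot ℕ)) :
    WithBot ℕ :=
  let G : Finset (Finset (Fin n)) := (Finset.univ.powersetCard s).filter
    (fun Y => jacobiNumber (A.submatrix id (Subtype.val : Y → Fin n)) ≠ ⊥)
  if h : G.Nonempty then G.inf' h (fun Y => jacobiNumber (A.submatrix id (Subtype.val : Y → Fin n))) else ⊥

/-! ### The decomposition algorithm -/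

section Decomposition

variable {s n : ℕ}

open Classical in
/-- The maximal number of zeros of `A` in rows of `R` and columns of `C` that lie in mutually
different rows and columns. -/
noncomputable def maxTransversalZeros (A : Matrix (Fin s) (Fin n) (WithBot ℕ))
    (R : Finset (Fin s)) (C : Finset (Fin n)) : ℕ :=
  ((R ×ˢ C).powerset.filter (fun T => (∀ e ∈ T, A e.1 e.2 = 0) ∧
    (∀ e ∈ T, ∀ e' ∈ T, e.1 = e'.1 → e = e') ∧
    (∀ e ∈ T, ∀ e' ∈ T, e.2 = e'.2 → e = e'))).sup Finset.card

/-- The zeros of the submatrix `R × C` all lie in a row of `R'` or a column of `C'`, and the number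
of these rows and columns is the maximal number of transversal zeros. -/
def IsKonigCover (A : Matrix (Fin s) (Fin n) (WithBot ℕ)) (R : Finset (Fin s))
    (C : Finset (Fin n)) (R' : Finset (Fin s)) (C' : Finset (Fin n)) : Prop :=
  R' ⊆ R ∧ C' ⊆ C ∧ (∀ i ∈ R, ∀ j ∈ C, A i j = 0 → i ∈ R' ∨ j ∈ C') ∧
    R'.card + C'.card = maxTransversalZeros A R C

open Classical in
/-- `R₀`: the row set, maximal for inclusion, of the Kőnig covers of the submatrix `R × C`
(Kőnig covers are stable under union of the row sets and intersection of the column sets). -/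
noncomputable def konigRows (A : Matrix (Fin s) (Fin n) (WithBot ℕ)) (R : Finset (Fin s))
    (C : Finset (Fin n)) : Finset (Fin s) :=
  Finset.univ.filter (fun i => ∃ R' C', IsKonigCover A R C R' C' ∧ i ∈ R')

open Classical in
/-- `C₀`: the column set, minimal for inclusion, of the Kőnig covers of the submatrix `R × C`. -/
noncomputable def konigCols (A : Matrix (Fin s) (Fin n) (WithBot ℕ)) (R : Finset (Fin s))
    (C : Finset (Fin n)) : Finset (Fin n) :=
  Finset.univ.filter (fun j => ∀ R' C', IsKonigCover A R C R' C' → j ∈ C')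

open Classical in
/-- The columns that, restricted to the rows `R`, contain only `0` or `-∞` and are not entirely
`-∞`. -/
noncomputable def zeroCols (A : Matrix (Fin s) (Fin n) (WithBot ℕ)) (R : Finset (Fin s)) :
    Finset (Fin n) :=
  Finset.univ.filter (fun j => (∀ i ∈ R, A i j = 0 ∨ A i j = ⊥) ∧ ∃ i ∈ R, A i j ≠ ⊥)

/-- The rows that remain after `k` steps of the algorithm; each step removes `R₀`. -/
noncomputable def remainingRows (A : Matrix (Fin s) (Fin n) (WithBot ℕ)) : ℕ → Finset (Fin s)
  | 0 => Finset.univ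
  | k + 1 => remainingRows A k \
      konigRows A (remainingRows A k) (zeroCols A (remainingRows A k))

/-- The number `p` of steps after which no row remains. -/
noncomputable def numBlocks (A : Matrix (Fin s) (Fin n) (WithBot ℕ)) : ℕ :=
  sInf {k : ℕ | remainingRows A k = ∅}

/-- The block of rows `h`, `1 ≤ h ≤ p`: the set `R₀` at step `p - h + 1` (steps are numbered from
`1`, so that `p - h` steps have been performed before). -/
noncomputable def blockRows (A : Matrix (Fin s) (Fin n) (WithBot ℕ)) (h : ℕ) : Finset (Fin s) :=
  konigRows A (remainingRows A (numBlocks A - h)) (zeroCols A (remainingRows A (numBlocks A - h)))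

/-- The block of columns `h`, `1 ≤ h ≤ p`: the columns of `B` that are not in `C₀` at step
`p - h + 1`. -/
noncomputable def blockCols (A : Matrix (Fin s) (Fin n) (WithBot ℕ)) (h : ℕ) : Finset (Fin n) :=
  zeroCols A (remainingRows A (numBlocks A - h)) \
    konigCols A (remainingRows A (numBlocks A - h))
      (zeroCols A (remainingRows A (numBlocks A - h)))

/-- The block `h` of a partition given by its level function. -/
def levelSet {m : ℕ} (lev : Fin m → ℕ) (h : ℕ) : Finset (Fin m) :=
  Finset.univ.filter (fun i => lev i = h)

/-- `A` is the order matrix of an order `1` block triangular system for the partition of the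
equations into levels `1, …, p` and of the variables into levels `0, …, p`. -/
structure IsOrderOneBlockTriangular (A : Matrix (Fin s) (Fin n) (WithBot ℕ)) (p : ℕ)
    (eqLev : Fin s → ℕ) (varLev : Fin n → ℕ) : Prop where
  eq_pos : ∀ i, 1 ≤ eqLev i
  eq_le : ∀ i, eqLev i ≤ p
  var_le : ∀ j, varLev j ≤ p
  free_above : ∀ i j, eqLev i < varLev j → A i j = ⊥
  order_one : ∀ i j, varLev j + 1 = eqLev i → A i j ≤ 1
  order_zero : ∀ i j, varLev j + 1 ≠ eqLev i → A i j ≤ 0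
  card_eq : ∀ h ∈ Finset.Icc 1 p, (levelSet varLev (h - 1)).card = (levelSet eqLev h).card
  jacobi_prev : ∀ h ∈ Finset.Icc 1 p,
    jacobiNumber (subBlock A (levelSet eqLev h) (levelSet varLev (h - 1))) =
      ((levelSet varLev (h - 1)).card : WithBot ℕ)
  jacobi_same : ∀ h ∈ Finset.Icc 1 p,
    jacobiNumber (subBlock A (levelSet eqLev h) (levelSet varLev h)) = 0

/-- `A` is the order matrix of a dense order `1` block triangular system, for some partition. -/
def IsDenseOrderOneBlockTriangular (A : Matrix (Fin s) (Fin n) (WithBot ℕ)) : Prop :=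
  ∃ (p : ℕ) (eqLev : Fin s → ℕ) (varLev : Fin n → ℕ),
    IsOrderOneBlockTriangular A p eqLev varLev ∧
      ∀ h ∈ Finset.Icc 1 p, ∀ i ∈ levelSet eqLev h, ∀ j ∈ levelSet varLev h, A i j = 0

end Decomposition

/-! ### Differential systems -/

/-- A system of `s` differential equations `P i = 0` in `n` variables, where the `P i` are analytic
functions of finitely many jet coordinates on a connected open subset of the jet space. -/
structure DiffSystem (s n : ℕ) where
  domain : Set (Jet n)
  isOpen_domain : IsOpen domain
  isPreconnected_domain : IsPreconnected domain
  P : Fin s → Jet n → ℝ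
  analytic : ∀ i, IsAnalyticJetFunction domain (P i)

namespace DiffSystem

variable {s n : ℕ}

/-- The order matrix `a_{i,j} = ord_{x_j} P_i`. -/
noncomputable def orderMatrix (S : DiffSystem s n) : Matrix (Fin s) (Fin n) (WithBot ℕ) :=
  Matrix.of fun i j => jetOrder S.domain (S.P i) j

/-- The Jacobian matrix `(∂P_i/∂x_j (η))`, with respect to the variables themselves. -/
noncomputable def jacobian (S : DiffSystem s n) (η : Jet n) : Matrix (Fin s) (Fin n) ℝ :=
  Matrix.of fun i j => jetPartial (S.P i) j 0 η

/-- `∂P_i/∂x_j^{(d)} (η)`, which is `0` if `d` is negative or `-∞`. -/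
noncomputable def partialAt (S : DiffSystem s n) (η : Jet n) (i : Fin s) (j : Fin n)
    (d : WithBot ℤ) : ℝ :=
  if 0 ≤ d then jetPartial (S.P i) j (d.unbotD 0).toNat η else 0

/-- The truncated determinant `∇_{Y,Σ}(η) = |∂P_i/∂x_j^{(α_i + β_j)} (η)|`, `j ∈ Y`, for the cover
`α, β` of the order matrix restricted to `Y` that is associated to the canon `l`. -/
noncomputable def truncatedDet (S : DiffSystem s n) (η : Jet n) (Y : Finset (Fin n))
    (hY : Y.card = s) (l : Fin s → ℕ) : ℝ :=
  Matrix.det (Matrix.of fun i k : Fin s =>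
    S.partialAt η i (Y.orderEmbOfFin hY k)
      (((coverRow l i : ℤ) : WithBot ℤ) + coverCol (colBlock S.orderMatrix Y hY) l k))

/-- `Σ` is oudephippical (an ō-system): its saddle Jacobi number is `0`. -/
def IsOSystem (S : DiffSystem s n) : Prop :=
  saddleJacobiNumber S.orderMatrix = 0

/-- The ō-system `Σ` is regular at `η`: for some set `Y` of `s` variables, the Jacobi number of `Σ`
in the variables of `Y` is the saddle Jacobi number, and the truncated determinant, formed with the
Jacobi cover (the cover associated to the minimal canon), does not vanish at `η`. -/
def IsORegularAt (S : DiffSystem s n) (η : Jet n) : Prop :=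
  S.IsOSystem ∧ ∃ (Y : Finset (Fin n)) (hY : Y.card = s),
    saddleJacobiNumber S.orderMatrix = jacobiNumber (colBlock S.orderMatrix Y hY) ∧
    ∃ l : Fin s → ℕ, IsMinimalCanon (colBlock S.orderMatrix Y hY) l ∧
      S.truncatedDet η Y hY l ≠ 0

end DiffSystem

/-! ### Linear algebra -/

/-! The main tool is a potential `α` for a transversal of zeros `σ`: `A i (σ k) + α k ≤ α i`.
Potentials witness that the columns `σ` have Jacobi number zero. They also make the Jacobian in
these columns block triangular: an entry with `α i < α k` is `-∞`, and one with `α i = α k` is `0`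
or `-∞`. The truncated determinant has the same diagonal blocks and is triangular the same way, so
`isORegularAt_iff` reduces regularity to a transversal of zeros with a potential and a nonzero minor
of `∂P/∂x`.

If all blocks have full rank, a nonzero minor of the block diagonal part of the Jacobian selects
columns inside the blocks, and the step at which a row is removed, suitably scaled, gives a
potential (`exists_isPotential_of_rank_blocks`).

Conversely, at each step the rows of maximal potential among the remaining ones belong to `R₀`, and
the corresponding columns avoid `C₀`. Nonsingularity of that diagonal block kills the coefficients
of these rows in any relation between the rows of `R₀` (`eq_zero_of_mem_topRows`). Under b) one
vanishing coefficient suffices, since the other rows are independent. Under a) the level of an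
equation is itself a potential and `R₀` consists exactly of the rows of top level, so every
coefficient vanishes. -/

theorem Matrix.BlockTriangular.det_congr {m α R : Type*} [CommRing R] [DecidableEq m] [Fintype m]
    [LinearOrder α] {M N : Matrix m m R} {b : m → α} (hM : M.BlockTriangular b)
    (hN : N.BlockTriangular b) (h : ∀ i j, b i = b j → M i j = N i j) : M.det = N.det := by
  rw [hM.det, hN.det]
  refine Finset.prod_congr rfl fun a _ => ?_
  congr 1
  ext ⟨i, hi⟩ ⟨j, hj⟩
  exact h i j (hi.trans hj.symm)

/-- If the columns are labelled so that nonzero entries have row label at least the column label,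
then the rows of a fixed label are independent on the columns of that label. -/
theorem Matrix.eq_zero_of_blockTriangular_of_det_ne_zero {m α : Type*} [DecidableEq m] [Fintype m]
    [LinearOrder α] {M : Matrix m m ℝ} {b : m → α}
    (hM : ∀ i j, b i < b j → M i j = 0) (hdet : M.det ≠ 0) (a : α) (c : m → ℝ)
    (hc : ∀ j, b j = a → ∑ i with b i = a, c i * M i j = 0) :
    ∀ i, b i = a → c i = 0 := by
  have hT : M.BlockTriangular (OrderDual.toDual ∘ b) := fun i j h => hM i j h
  rw [hT.det] at hdet
  intro i hi
  have h1 := Finset.prod_ne_zero_iff.1 hdet (OrderDual.toDual a)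
    (Finset.mem_image.2 ⟨i, Finset.mem_univ _, by simp [hi]⟩)
  have h2 := Matrix.eq_zero_of_vecMul_eq_zero h1
    (v := fun k => c k.1) (by
      ext ⟨j, hj⟩
      have hj' : b j = a := hj
      rw [Pi.zero_apply, ← hc j hj', Matrix.vecMul, dotProduct,
        ← Finset.sum_subtype_eq_sum_filter]
      symm
      refine Finset.sum_bij (fun x _ => ⟨x.1, ?_⟩) ?_ ?_ ?_ ?_
      · rcases x with ⟨x, hx⟩
        simpa using hx
      · simp
      · intro x _ y _ h
        simpa [Subtype.ext_iff] using h
      · rintro ⟨x, hx⟩ -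
        have hx' : b x = a := hx
        exact ⟨⟨x, hx'⟩, by simp, rfl⟩
      · rintro ⟨x, hx⟩ _
        rfl)
  exact congrFun h2 ⟨i, by simp [hi]⟩

/-- The coefficients live on all of `ι`, so that one family `c` can be tested on a block of rows and
on the same block with a row erased. -/
theorem rank_subBlock_eq_card_iff {ι κ : Type*} (J : Matrix ι κ ℝ) (R : Finset ι) (C : Finset κ) :
    (subBlock J R C).rank = R.card ↔
      ∀ c : ι → ℝ, (∀ j ∈ C, ∑ i ∈ R, c i * J i j = 0) → ∀ i ∈ R, c i = 0 := by
  classical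
  have h1 : (subBlock J R C).rank = R.card ↔
      LinearIndependent ℝ (fun i : R => (subBlock J R C).row i) := by
    rw [linearIndependent_iff_card_eq_finrank_span, Matrix.rank_eq_finrank_span_row,
      Fintype.card_coe, eq_comm]
    rfl
  rw [h1, Fintype.linearIndependent_iff]
  constructor
  · intro h c hc i hi
    refine h (fun i => c i) ?_ ⟨i, hi⟩
    ext ⟨j, hj⟩
    rw [Finset.sum_apply, Pi.zero_apply, ← hc j hj, ← Finset.sum_coe_sort R]
    rfl
  · intro h g hg i
    have := h (fun i => if hi : i ∈ R then g ⟨i, hi⟩ else 0) (by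
      intro j hj
      have h2 := congrFun hg ⟨j, hj⟩
      rw [Finset.sum_apply, Pi.zero_apply] at h2
      rw [← h2, ← Finset.sum_coe_sort R]
      refine Finset.sum_congr rfl fun x _ => ?_
      simp [subBlock]) i i.2
    simpa using this

/-- Row rank equals column rank, so a basis of the column space extracted from the columns has
exactly `s` members. -/
theorem exists_injective_det_submatrix_ne_zero {s n : ℕ} (M : Matrix (Fin s) (Fin n) ℝ)
    (hM : ∀ c : Fin s → ℝ, (∀ j, ∑ i, c i * M i j = 0) → c = 0) :
    ∃ σ : Fin s → Fin n, Function.Injective σ ∧ (M.submatrix id σ).det ≠ 0 := by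
  have hli : LinearIndependent ℝ M.row := by
    rw [Fintype.linearIndependent_iff]
    intro g hg i
    refine congrFun (hM g fun j => ?_) i
    have := congrFun hg j
    simpa [Finset.sum_apply] using this
  have hrank : M.rank = s := by simpa using hli.rank_matrix
  obtain ⟨κ, a, ha, hspan, hind⟩ := exists_linearIndependent' ℝ M.col
  have : Finite κ := Finite.of_injective a ha
  have := Fintype.ofFinite κ
  have hcard : Fintype.card κ = s := by
    rw [linearIndependent_iff_card_eq_finrank_span.1 hind, Set.finrank, hspan,
      ← Matrix.rank_eq_finrank_span_cols, hrank]
  let e : Fin s ≃ κ := (Fintype.equivFinOfCardEq hcard).symm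
  refine ⟨a ∘ e, ha.comp e.injective, ?_⟩
  have h2 : LinearIndependent ℝ (M.submatrix id (a ∘ e)).col := hind.comp e e.injective
  rw [Matrix.linearIndependent_cols_iff_isUnit, Matrix.isUnit_iff_isUnit_det] at h2
  exact h2.ne_zero

/-! ### Kőnig covers -/

section KonigCovers

variable {s n : ℕ} {A : Matrix (Fin s) (Fin n) (WithBot ℕ)} {R : Finset (Fin s)}
  {C : Finset (Fin n)}

/-- The easy half of Kőnig duality: each covering line contains at most one zero of a transversal
family. -/
theorem maxTransversalZeros_le_of_cover {R' : Finset (Fin s)} {C' : Finset (Fin n)}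
    (h : ∀ i ∈ R, ∀ j ∈ C, A i j = 0 → i ∈ R' ∨ j ∈ C') :
    maxTransversalZeros A R C ≤ R'.card + C'.card := by
  classical
  unfold maxTransversalZeros
  refine Finset.sup_le fun T hT => ?_
  simp only [Finset.mem_filter, Finset.mem_powerset] at hT
  obtain ⟨hsub, h0, h1, h2⟩ := hT
  have hle : T ⊆ T.filter (fun e => e.1 ∈ R') ∪ T.filter (fun e => e.2 ∈ C') := by
    intro e he
    have := Finset.mem_product.1 (hsub he)
    rcases h e.1 this.1 e.2 this.2 (h0 e he) with h' | h' <;> simp [he, h']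
  refine (Finset.card_le_card hle).trans ((Finset.card_union_le _ _).trans (Nat.add_le_add ?_ ?_))
  · refine Finset.card_le_card_of_injOn Prod.fst (fun e he => (Finset.mem_filter.1 he).2) ?_
    intro e he e' he' hee
    exact h1 e (Finset.mem_filter.1 he).1 e' (Finset.mem_filter.1 he').1 hee
  · refine Finset.card_le_card_of_injOn Prod.snd (fun e he => (Finset.mem_filter.1 he).2) ?_
    intro e he e' he' hee
    exact h2 e (Finset.mem_filter.1 he).1 e' (Finset.mem_filter.1 he').1 hee

theorem isKonigCover_of_card_le {R' : Finset (Fin s)} {C' : Finset (Fin n)} (hR : R' ⊆ R)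
    (hC : C' ⊆ C) (h : ∀ i ∈ R, ∀ j ∈ C, A i j = 0 → i ∈ R' ∨ j ∈ C')
    (hcard : R'.card + C'.card ≤ maxTransversalZeros A R C) : IsKonigCover A R C R' C' :=
  ⟨hR, hC, h, le_antisymm hcard (maxTransversalZeros_le_of_cover h)⟩

/-- Kőnig's theorem, deduced from Hall's theorem by adding as many columns of zeros as the
deficiency. -/
theorem exists_isKonigCover (A : Matrix (Fin s) (Fin n) (WithBot ℕ)) (R : Finset (Fin s))
    (C : Finset (Fin n)) : ∃ R' C', IsKonigCover A R C R' C' := by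
  classical
  let N : Finset (Fin s) → Finset (Fin n) := fun S => C.filter (fun j => ∃ i ∈ S, A i j = 0)
  obtain ⟨S₀, hS₀, hd⟩ := Finset.exists_mem_eq_sup R.powerset ⟨∅, by simp⟩
    (fun S => S.card - (N S).card)
  -- `d` is the deficiency in Hall's condition, attained at `S₀`. The summand `Fin d` in `t` below
  -- supplies the added columns.
  set d := R.powerset.sup (fun S => S.card - (N S).card) with hd_def
  have hdef : ∀ S ⊆ R, S.card ≤ (N S).card + d := by
    intro S hS
    have := Finset.le_sup (f := fun S => S.card - (N S).card) (Finset.mem_powerset.2 hS)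
    omega
  let t : R → Finset (Fin n ⊕ Fin d) := fun i =>
    (C.filter (fun j => A i j = 0)).disjSum Finset.univ
  obtain ⟨f, hf, hft⟩ := (Finset.all_card_le_biUnion_card_iff_exists_injective t).1 (by
    intro S
    rcases S.eq_empty_or_nonempty with rfl | ⟨i₀, hi₀⟩
    · simp
    have hsub : (N (S.map (Function.Embedding.subtype _))).disjSum Finset.univ ⊆ S.biUnion t := by
      intro x hx
      rw [Finset.mem_biUnion]
      rcases x with j | k
      · rw [Finset.inl_mem_disjSum] at hx
        obtain ⟨hj, i, hi, hij⟩ := Finset.mem_filter.1 hx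
        obtain ⟨i', hi', rfl⟩ := Finset.mem_map.1 hi
        exact ⟨i', hi', Finset.inl_mem_disjSum.2 (Finset.mem_filter.2 ⟨hj, hij⟩)⟩
      · exact ⟨i₀, hi₀, Finset.inr_mem_disjSum.2 (Finset.mem_univ _)⟩
    have h1 := Finset.card_le_card hsub
    rw [Finset.card_disjSum, Finset.card_univ, Fintype.card_fin] at h1
    have h2 := hdef (S.map (Function.Embedding.subtype _)) (by
      intro i hi
      obtain ⟨i', _, rfl⟩ := Finset.mem_map.1 hi
      exact i'.2)
    rw [Finset.card_map] at h2
    exact h2.trans h1)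
  let T : Finset (Fin s × Fin n) :=
    (R ×ˢ C).filter (fun e => ∃ h : e.1 ∈ R, f ⟨e.1, h⟩ = Sum.inl e.2)
  have hzero : ∀ (i : R) (j : Fin n), f i = Sum.inl j → j ∈ C ∧ A i j = 0 := by
    intro i j hij
    have := hft i
    rw [hij, Finset.inl_mem_disjSum] at this
    exact Finset.mem_filter.1 this
  have hT : T.card ≤ maxTransversalZeros A R C := by
    unfold maxTransversalZeros
    refine Finset.le_sup (f := Finset.card) (Finset.mem_filter.2
      ⟨Finset.mem_powerset.2 (Finset.filter_subset _ _), ?_, ?_, ?_⟩)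
    · intro e he
      obtain ⟨_, h, hfe⟩ := Finset.mem_filter.1 he
      exact (hzero _ _ hfe).2
    · rintro ⟨i, j⟩ he ⟨i', j'⟩ he' rfl
      obtain ⟨_, h, hfe⟩ := Finset.mem_filter.1 he
      obtain ⟨_, h', hfe'⟩ := Finset.mem_filter.1 he'
      have := hfe.symm.trans hfe'
      simpa using this
    · rintro ⟨i, j⟩ he ⟨i', j'⟩ he' rfl
      obtain ⟨_, h, hfe⟩ := Finset.mem_filter.1 he
      obtain ⟨_, h', hfe'⟩ := Finset.mem_filter.1 he'
      have := hf (hfe.trans hfe'.symm)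
      simpa using this
  -- At most `d` rows are matched to added columns; the others give the transversal `T`.
  have hRT : R.card ≤ T.card + d := by
    have hsub : Finset.univ.image f ⊆ (T.image Prod.snd).disjSum Finset.univ := by
      intro x hx
      obtain ⟨i, -, rfl⟩ := Finset.mem_image.1 hx
      cases hfi : f i with
      | inl j =>
        refine Finset.inl_mem_disjSum.2 (Finset.mem_image.2 ⟨(i.1, j), ?_, rfl⟩)
        exact Finset.mem_filter.2
          ⟨Finset.mem_product.2 ⟨i.2, (hzero i j hfi).1⟩, i.2, hfi⟩
      | inr k => exact Finset.inr_mem_disjSum.2 (Finset.mem_univ _)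
    have h1 := Finset.card_le_card hsub
    rw [Finset.card_image_of_injective _ hf, Finset.card_univ, Fintype.card_coe,
      Finset.card_disjSum, Finset.card_univ, Fintype.card_fin] at h1
    exact h1.trans (Nat.add_le_add_right Finset.card_image_le _)
  -- For `d = 0` the truncated subtraction says only that `S₀` has at least as many neighbours as
  -- elements, so all of `R` serves as cover. For `d > 0` the cover by `R \ S₀` and `N S₀` has
  -- exactly `R.card - d` lines.
  rcases Nat.eq_zero_or_pos d with h0 | hpos
  · exact ⟨R, ∅, isKonigCover_of_card_le subset_rfl (Finset.empty_subset _)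
      (fun i hi _ _ _ => Or.inl hi) (by rw [Finset.card_empty]; omega)⟩
  · refine ⟨R \ S₀, N S₀, isKonigCover_of_card_le Finset.sdiff_subset (Finset.filter_subset _ _)
      ?_ ?_⟩
    · intro i hi j hj hij
      by_cases hiS : i ∈ S₀
      · exact Or.inr (Finset.mem_filter.2 ⟨hj, i, hiS, hij⟩)
      · exact Or.inl (Finset.mem_sdiff.2 ⟨hi, hiS⟩)
    · have hsub := Finset.mem_powerset.1 hS₀
      rw [Finset.card_sdiff_of_subset hsub]
      have := Finset.card_le_card hsub
      omega

theorem mem_konigRows {i : Fin s} :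
    i ∈ konigRows A R C ↔ ∃ R' C', IsKonigCover A R C R' C' ∧ i ∈ R' := by
  simp [konigRows]

theorem mem_konigCols {j : Fin n} :
    j ∈ konigCols A R C ↔ ∀ R' C', IsKonigCover A R C R' C' → j ∈ C' := by
  simp [konigCols]

theorem konigRows_subset : konigRows A R C ⊆ R := by
  intro i hi
  obtain ⟨R', C', h, hi'⟩ := mem_konigRows.1 hi
  exact h.1 hi'

/-- A zero in a column outside `C₀` lies in a row of `R₀`. -/
theorem mem_konigRows_of_eq_zero {i : Fin s} {j : Fin n} (hi : i ∈ R) (hj : j ∈ C)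
    (hj' : j ∉ konigCols A R C) (h : A i j = 0) : i ∈ konigRows A R C := by
  simp only [mem_konigCols, not_forall] at hj'
  obtain ⟨R', C', hc, hjC⟩ := hj'
  refine mem_konigRows.2 ⟨R', C', hc, ?_⟩
  exact (hc.2.2.1 i hi j hj h).resolve_right hjC

/-- A row of `R₀` contains a zero. -/
theorem exists_eq_zero_of_mem_konigRows {i : Fin s} (hi : i ∈ konigRows A R C) :
    ∃ j ∈ C, A i j = 0 := by
  classical
  by_contra! hne
  obtain ⟨R', C', hc, hiR⟩ := mem_konigRows.1 hi
  have h := maxTransversalZeros_le_of_cover (A := A) (R := R) (C := C) (R' := R'.erase i)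
    (C' := C') (by
      intro i' hi' j hj h0
      refine (hc.2.2.1 i' hi' j hj h0).imp_left fun h => Finset.mem_erase.2 ⟨?_, h⟩
      rintro rfl
      exact hne j hj h0)
  rw [← hc.2.2.2, Finset.card_erase_of_mem hiR] at h
  have := Finset.card_pos.2 ⟨i, hiR⟩
  omega

/-- If the zeros in the columns `W` all lie in the rows `T`, which are matched to columns of `W`,
then `T` is contained in `R₀` and `W` does not meet `C₀`. -/
theorem konig_of_matched {T : Finset (Fin s)} {W : Finset (Fin n)} (hTR : T ⊆ R)
    (hzero : ∀ i ∈ R, ∀ j ∈ W, A i j = 0 → i ∈ T) (hWC : W ⊆ C) (f : Fin s → Fin n)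
    (hf : Set.InjOn f T) (hfW : ∀ i ∈ T, f i ∈ W) (hf0 : ∀ i ∈ T, A i (f i) = 0) :
    T ⊆ konigRows A R C ∧ Disjoint W (konigCols A R C) := by
  classical
  obtain ⟨R', C', hR', hC', hc, hcard⟩ := exists_isKonigCover A R C
  -- The matched zero of a row of `T` outside `R'` must be covered by its column. Hence replacing
  -- the columns `C' ∩ W` by the rows `T \ R'` does not enlarge the cover.
  have hle : (T \ R').card ≤ (C' ∩ W).card := by
    refine Finset.card_le_card_of_injOn f ?_ (hf.mono ?_)
    · intro i hi
      obtain ⟨hiT, hiR⟩ := Finset.mem_sdiff.1 hi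
      exact Finset.mem_inter.2 ⟨(hc i (hTR hiT) _ (hWC (hfW i hiT)) (hf0 i hiT)).resolve_left hiR,
        hfW i hiT⟩
    · intro i hi
      exact (Finset.mem_sdiff.1 hi).1
  have hK : IsKonigCover A R C (R' ∪ T) (C' \ W) := by
    refine isKonigCover_of_card_le (Finset.union_subset hR' hTR)
      (Finset.sdiff_subset.trans hC') ?_ ?_
    · intro i hi j hj h0
      by_cases hjW : j ∈ W
      · exact Or.inl (Finset.mem_union_right _ (hzero i hi j hjW h0))
      · exact (hc i hi j hj h0).imp (Finset.mem_union_left _)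
          fun h => Finset.mem_sdiff.2 ⟨h, hjW⟩
    · have h1 := Finset.card_sdiff_add_card R' T
      have h2 := Finset.card_sdiff_add_card T R'
      have h3 := Finset.card_sdiff_add_card_inter C' W
      rw [Finset.union_comm] at h2
      omega
  constructor
  · intro i hi
    exact mem_konigRows.2 ⟨_, _, hK, Finset.mem_union_right _ hi⟩
  · rw [Finset.disjoint_left]
    intro j hjW hj
    exact (Finset.mem_sdiff.1 (mem_konigCols.1 hj _ _ hK)).2 hjW

end KonigCovers

/-! ### Potentials and canons -/

/-- A potential for the columns `σ`: the longest path inequalities of the matrix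
`A i (σ k)`. -/
def IsPotential {ι κ : Type*} (A : Matrix ι κ (WithBot ℕ)) (σ : ι → κ) (α : ι → ℕ) : Prop :=
  ∀ i k, A i (σ k) + (α k : WithBot ℕ) ≤ (α i : WithBot ℕ)

theorem WithBot.exists_natCast_of_ne_bot {x : WithBot ℕ} (h : x ≠ ⊥) : ∃ a : ℕ, x = a :=
  ⟨x.unbot h, (WithBot.coe_unbot x h).symm⟩

theorem isPotential_iff {ι κ : Type*} {A : Matrix ι κ (WithBot ℕ)} {σ : ι → κ} {α : ι → ℕ} :
    IsPotential A σ α ↔ ∀ i k (a : ℕ), A i (σ k) = a → a + α k ≤ α i := by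
  refine forall₂_congr fun i k => ?_
  rcases eq_or_ne (A i (σ k)) ⊥ with h | h
  · simp [h]
  · obtain ⟨a, ha⟩ := WithBot.exists_natCast_of_ne_bot h
    rw [ha]
    constructor
    · rintro h' b hb
      obtain rfl : a = b := by exact_mod_cast hb
      exact_mod_cast h'
    · intro h'
      exact_mod_cast h' a rfl

theorem WithBot.sum_natCast_eq {ι : Type*} [Fintype ι] {x : ι → WithBot ℕ} {a : ι → ℕ}
    (h : ∀ i, x i = a i) : ∑ i, x i = ((∑ i, a i : ℕ) : WithBot ℕ) := by
  rw [Nat.cast_sum]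
  exact Finset.sum_congr rfl fun i _ => h i

theorem WithBot.exists_natCast_of_sum_ne_bot {ι : Type*} [Fintype ι] {x : ι → WithBot ℕ}
    (h : ∑ i, x i ≠ ⊥) : ∃ a : ι → ℕ, ∀ i, x i = a i := by
  have : ∀ i, ∃ a : ℕ, x i = a := fun i => WithBot.exists_natCast_of_ne_bot fun hi =>
    h (WithBot.sum_eq_bot_iff.2 ⟨i, Finset.mem_univ _, hi⟩)
  choose a ha using this
  exact ⟨a, ha⟩

section Jacobi

variable {ι κ : Type*} [Fintype ι] [Fintype κ]

theorem le_jacobiNumber (A : Matrix ι κ (WithBot ℕ)) (σ : ι ↪ κ) :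
    ∑ i, A i (σ i) ≤ jacobiNumber A := by
  classical
  exact Finset.le_sup (f := fun σ : ι ↪ κ => ∑ i, A i (σ i)) (Finset.mem_univ σ)

theorem exists_eq_jacobiNumber {A : Matrix ι κ (WithBot ℕ)} (h : jacobiNumber A ≠ ⊥) :
    ∃ σ : ι ↪ κ, ∑ i, A i (σ i) = jacobiNumber A := by
  classical
  unfold jacobiNumber at h ⊢
  rcases (Finset.univ : Finset (ι ↪ κ)).eq_empty_or_nonempty with he | hne
  · rw [he, Finset.sup_empty] at h
    exact absurd rfl h
  · obtain ⟨σ, -, hσ⟩ := Finset.exists_mem_eq_sup _ hne (fun σ : ι ↪ κ => ∑ i, A i (σ i))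
    exact ⟨σ, hσ.symm⟩

theorem exists_zeros_of_jacobiNumber_eq_zero {A : Matrix ι κ (WithBot ℕ)}
    (h : jacobiNumber A = 0) : ∃ σ : ι ↪ κ, ∀ i, A i (σ i) = 0 := by
  obtain ⟨σ, hσ⟩ := exists_eq_jacobiNumber (A := A) (by simp [h])
  rw [h] at hσ
  obtain ⟨a, ha⟩ := WithBot.exists_natCast_of_sum_ne_bot (x := fun i => A i (σ i)) (by simp [hσ])
  rw [WithBot.sum_natCast_eq ha] at hσ
  have h0 : ∑ i, a i = 0 := by exact_mod_cast hσ
  refine ⟨σ, fun i => ?_⟩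
  rw [ha, Finset.sum_eq_zero_iff.1 h0 i (Finset.mem_univ _)]
  rfl

theorem jacobiNumber_submatrix_equiv {κ' : Type*} [Fintype κ'] (A : Matrix ι κ (WithBot ℕ))
    (e : κ' ≃ κ) : jacobiNumber (A.submatrix id e) = jacobiNumber A := by
  classical
  refine le_antisymm (Finset.sup_le fun σ _ => ?_) (Finset.sup_le fun σ _ => ?_)
  · exact le_jacobiNumber A (σ.trans e.toEmbedding)
  · simpa using le_jacobiNumber (A.submatrix id e) (σ.trans e.symm.toEmbedding)

end Jacobi

theorem isCanon_of_add_le {ι : Type*} {M : Matrix ι ι (WithBot ℕ)} {l : ι → ℕ} {π : Equiv.Perm ι} (hπ : ∀ i, M i (π i) = 0)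
    (h : ∀ i i', M i' (π i) + (l i' : WithBot ℕ) ≤ (l i : WithBot ℕ)) : IsCanon M l :=
  ⟨π.toEmbedding, fun i i' => by simpa [hπ] using h i i'⟩

/-! ### Square matrices with Jacobi number zero: potentials and minimal canons -/

section Square

variable {ι : Type*} [Fintype ι] {M : Matrix ι ι (WithBot ℕ)}

/-- Summing the inequalities over a transversal of finite entries, the potentials cancel, so its sum
is at most zero. -/
theorem jacobiNumber_eq_zero_of_isPotential {π : Equiv.Perm ι} {α : ι → ℕ}
    (hα : IsPotential M π α) (hπ : ∀ i, M i (π i) = 0) : jacobiNumber M = 0 := by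
  classical
  refine le_antisymm (Finset.sup_le fun τ _ => ?_) ?_
  · by_cases hbot : ∑ i, M i (τ i) = ⊥
    · rw [hbot]
      exact bot_le
    obtain ⟨a, ha⟩ := WithBot.exists_natCast_of_sum_ne_bot hbot
    rw [WithBot.sum_natCast_eq ha]
    have h1 : ∀ i, a i + α (π.symm (τ i)) ≤ α i := fun i =>
      isPotential_iff.1 hα i (π.symm (τ i)) (a i) (by simpa using ha i)
    have h2 := Finset.sum_le_sum fun i (_ : i ∈ Finset.univ) => h1 i
    have h3 : ∑ i, α (π.symm (τ i)) = ∑ i, α i :=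
      Equiv.sum_comp ((Equiv.ofBijective τ (Finite.injective_iff_bijective.1 τ.injective)).trans
        π.symm) α
    rw [Finset.sum_add_distrib, h3] at h2
    have h4 : ∑ i, a i = 0 := by omega
    rw [h4]
    rfl
  · have := le_jacobiNumber M π.toEmbedding
    simpa [hπ] using this

/-- The inequalities of a canon hold for every transversal of zeros. -/
theorem IsCanon.add_le (hM : jacobiNumber M = 0) {l : ι → ℕ} (hl : IsCanon M l)
    {π : Equiv.Perm ι} (hπ : ∀ i, M i (π i) = 0) (i i' : ι) :
    M i' (π i) + (l i' : WithBot ℕ) ≤ (l i : WithBot ℕ) := by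
  obtain ⟨σ, hσ⟩ := hl
  let σ' : Equiv.Perm ι := Equiv.ofBijective σ (Finite.injective_iff_bijective.1 σ.injective)
  -- `ρ i` is the row that the canon's own transversal `σ` assigns to the column `π i`. The entries
  -- of `σ` turn out to be zero, so `l i ≤ l (ρ i)`; both sides have the same sum, which forces
  -- equality.
  let ρ : Equiv.Perm ι := π.trans σ'.symm
  have hρ : ∀ i, σ (ρ i) = π i := fun i => σ'.apply_symm_apply (π i)
  have h1 : ∀ i i', M i' (π i) + (l i' : WithBot ℕ) ≤ M (ρ i) (σ (ρ i)) + (l (ρ i) : WithBot ℕ) :=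
    fun i i' => by simpa [hρ] using hσ (ρ i) i'
  have h2 : ∀ k, ∃ m : ℕ, M k (σ k) = m := fun k =>
    WithBot.exists_natCast_of_ne_bot fun hk => by
      have := h1 (ρ.symm k) (ρ.symm k)
      rw [Equiv.apply_symm_apply, hk, hπ, WithBot.bot_add, zero_add, le_bot_iff] at this
      exact WithBot.coe_ne_bot this
  choose m hm using h2
  have hm0 : ∑ i, m i = 0 := by
    have := le_jacobiNumber M σ
    rw [hM, WithBot.sum_natCast_eq hm] at this
    exact Nat.le_zero.1 (by exact_mod_cast this)
  have hm1 : ∀ k, m k = 0 := fun k => Finset.sum_eq_zero_iff.1 hm0 k (Finset.mem_univ _)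
  have h3 : ∀ i, l i ≤ l (ρ i) := fun i => by
    have := h1 i i
    rw [hπ, hm, hm1, zero_add] at this
    simpa using this
  have h4 : ∑ i, l (ρ i) = ∑ i, l i := Equiv.sum_comp ρ l
  have h5 : l i = l (ρ i) :=
    (Finset.sum_eq_sum_iff_of_le fun i _ => h3 i).1 h4.symm i (Finset.mem_univ _)
  have h6 := h1 i i'
  rw [hm, hm1, ← h5] at h6
  simpa using h6

theorem IsCanon.isPotential_coverRow (hM : jacobiNumber M = 0) {l : ι → ℕ} (hl : IsCanon M l)
    {π : Equiv.Perm ι} (hπ : ∀ i, M i (π i) = 0) : IsPotential M π (coverRow l) := by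
  refine isPotential_iff.2 fun i k a ha => ?_
  have h := hl.add_le hM hπ k i
  rw [ha] at h
  have h' : a + l i ≤ l k := by exact_mod_cast h
  have h1 : l k ≤ Finset.univ.sup l := Finset.le_sup (Finset.mem_univ k)
  simp only [coverRow]
  omega

/-- For a fixed transversal of zeros, canons are the solutions of a system of difference
inequalities, which is stable under pointwise infimum. A potential turned upside down, `coverRow α`,
is one solution. -/
theorem exists_isMinimalCanon {π : Equiv.Perm ι} {α : ι → ℕ}
    (hα : IsPotential M π α) (hπ : ∀ i, M i (π i) = 0) : ∃ l, IsMinimalCanon M l := by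
  have hM := jacobiNumber_eq_zero_of_isPotential hα hπ
  have hne : IsCanon M (coverRow α) := by
    refine isCanon_of_add_le hπ fun i i' => ?_
    rcases eq_or_ne (M i' (π i)) ⊥ with h | h
    · simp [h]
    · obtain ⟨a, ha⟩ := WithBot.exists_natCast_of_ne_bot h
      have h1 := isPotential_iff.1 hα i' i a ha
      rw [ha]
      have h2 : α i' ≤ Finset.univ.sup α := Finset.le_sup (Finset.mem_univ i')
      have h3 : a + coverRow α i' ≤ coverRow α i := by
        simp only [coverRow]
        omega
      exact_mod_cast h3
  let l : ι → ℕ := fun i => sInf {m | ∃ c, IsCanon M c ∧ c i = m}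
  have hle : ∀ c, IsCanon M c → l ≤ c := fun c hc i => Nat.sInf_le ⟨c, hc, rfl⟩
  refine ⟨l, isCanon_of_add_le hπ fun i i' => ?_, fun c hc => hle c hc⟩
  obtain ⟨c, hc, hci⟩ := Nat.sInf_mem (s := {m | ∃ c, IsCanon M c ∧ c i = m}) ⟨_, _, hne, rfl⟩
  have hli : c i = l i := hci
  rw [← hli]
  refine le_trans ?_ (hc.add_le hM hπ i i')
  have : (l i' : WithBot ℕ) ≤ (c i' : WithBot ℕ) := by exact_mod_cast hle c hc i'
  gcongr

/-- If no transversal of finite entries has positive sum and the diagonal is zero, then a positive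
entry `(i, k)` prevents `k` from reaching `i` along finite entries. -/
theorem not_reflTransGen_of_pos (hM : jacobiNumber M = 0) (hd : ∀ i, M i i = 0) {i k : ι}
    (hik : 0 < M i k) : ¬ Relation.ReflTransGen (fun a b => M a b ≠ ⊥) k i := by
  classical
  intro hreach
  -- Row `i` is forced onto column `k`, every other row onto a finite entry: a matching would be a
  -- transversal of positive sum.
  let t : ι → Finset ι := fun a => if a = i then {k} else Finset.univ.filter (fun b => M a b ≠ ⊥)
  have hself : ∀ a, a ≠ i → a ∈ t a := fun a ha => by simp [t, ha, hd]
  have hki : k ≠ i := by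
    rintro rfl
    simp [hd] at hik
  obtain ⟨f, hf, hft⟩ := (Finset.all_card_le_biUnion_card_iff_exists_injective t).1 (by
    intro S
    by_cases hi : i ∈ S
    · have hk : k ∈ S.biUnion t := Finset.mem_biUnion.2 ⟨i, hi, by simp [t]⟩
      have hS : S.erase i ⊆ S.biUnion t := fun a ha =>
        Finset.mem_biUnion.2 ⟨a, (Finset.mem_erase.1 ha).2, hself a (Finset.mem_erase.1 ha).1⟩
      -- Otherwise `S.erase i` contains `k` and is closed under finite entries, hence contains `i`,
      -- which is reachable from `k`.
      have hext : ∃ m ∈ S.biUnion t, m ∉ S.erase i := by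
        by_contra! hcl
        have : ∀ b, Relation.ReflTransGen (fun a b => M a b ≠ ⊥) k b → b ∈ S.erase i := by
          intro b hb
          induction hb with
          | refl => exact hcl k hk
          | tail _ hbc ih =>
            refine hcl _ (Finset.mem_biUnion.2 ⟨_, (Finset.mem_erase.1 ih).2, ?_⟩)
            simp [t, (Finset.mem_erase.1 ih).1, hbc]
        exact (Finset.mem_erase.1 (this i hreach)).1 rfl
      obtain ⟨m, hm, hmS⟩ := hext
      have := Finset.card_le_card (Finset.insert_subset hm hS)
      rw [Finset.card_insert_of_notMem hmS, Finset.card_erase_of_mem hi] at this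
      have := Finset.card_pos.2 ⟨i, hi⟩
      omega
    · exact Finset.card_le_card fun a ha => Finset.mem_biUnion.2
        ⟨a, ha, hself a (by rintro rfl; exact hi ha)⟩)
  have hfi : f i = k := by simpa [t] using hft i
  have hfin : ∀ a, ∃ m : ℕ, M a (f a) = m := fun a => WithBot.exists_natCast_of_ne_bot (by
    by_cases ha : a = i
    · subst ha
      rw [hfi]
      exact hik.ne_bot
    · simpa [t, ha] using hft a)
  choose m hm using hfin
  have h1 : ∑ a, M a (f a) ≤ _ := le_jacobiNumber M ⟨f, hf⟩
  rw [hM] at h1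
  rw [WithBot.sum_natCast_eq hm] at h1
  have h2 : ∑ a, m a = 0 := Nat.le_zero.1 (by exact_mod_cast h1)
  have h3 := Finset.sum_eq_zero_iff.1 h2 i (Finset.mem_univ _)
  have h4 := hm i
  rw [hfi, h3] at h4
  rw [h4] at hik
  simp at hik

/-- The potential counts the rows reachable from `i`, scaled by a bound `N` for all finite entries.
Reachable sets shrink along a finite entry, and strictly along a positive one by
`not_reflTransGen_of_pos`. -/
theorem exists_isPotential_id (hM : jacobiNumber M = 0) (hd : ∀ i, M i i = 0) :
    ∃ α, IsPotential M id α := by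
  classical
  let E : ι → ι → Prop := fun a b => M a b ≠ ⊥
  let r : ι → Finset ι := fun i => Finset.univ.filter (fun k => Relation.ReflTransGen E i k)
  let N : ℕ := Finset.univ.sup (fun p : ι × ι => (M p.1 p.2).unbotD 0)
  refine ⟨fun i => N * (r i).card, isPotential_iff.2 fun i k a ha => ?_⟩
  have hE : E i k := by simp only [id] at ha; simp [E, ha]
  have hsub : r k ⊆ r i := fun b hb => by
    simp only [r, Finset.mem_filter, Finset.mem_univ, true_and] at hb ⊢
    exact Relation.ReflTransGen.head hE hb
  have haN : a ≤ N := by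
    have := Finset.le_sup (f := fun p : ι × ι => (M p.1 p.2).unbotD 0) (Finset.mem_univ (i, k))
    simp only [id] at ha
    simp only [ha] at this
    exact this
  rcases Nat.eq_zero_or_pos a with rfl | hpos
  · rw [zero_add]
    exact Nat.mul_le_mul_left _ (Finset.card_le_card hsub)
  · have hlt : (r k).card < (r i).card := by
      refine Finset.card_lt_card ⟨hsub, fun h => ?_⟩
      have : i ∈ r k := h (by simp [r, Relation.ReflTransGen.refl])
      refine not_reflTransGen_of_pos hM hd (i := i) (k := k) ?_
        (by simpa [r] using this)
      simp only [id] at ha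
      rw [ha]
      exact_mod_cast hpos
    nlinarith

theorem exists_isPotential {π : Equiv.Perm ι} (hM : jacobiNumber M = 0)
    (hπ : ∀ i, M i (π i) = 0) : ∃ α, IsPotential M π α :=
  exists_isPotential_id (M := M.submatrix id π)
    (by rw [jacobiNumber_submatrix_equiv, hM]) hπ

end Square

/-! ### Regularity in terms of potentials -/

/-- The potential inequality says that the maximum defining the column part is attained on the
transversal, where the entry is zero. -/
theorem coverCol_eq_of_isPotential {ι : Type*} [Fintype ι] {M : Matrix ι ι (WithBot ℕ)}
    {π : Equiv.Perm ι} {l : ι → ℕ} (hα : IsPotential M π (coverRow l))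
    (hπ : ∀ i, M i (π i) = 0) (k : ι) :
    coverCol M l (π k) = ((-(coverRow l k : ℤ) : ℤ) : WithBot ℤ) := by
  refine le_antisymm (Finset.sup_le fun i _ => ?_) ?_
  · rcases eq_or_ne (M i (π k)) ⊥ with h | h
    · simp [h]
    · obtain ⟨a, ha⟩ := WithBot.exists_natCast_of_ne_bot h
      have h1 := isPotential_iff.1 hα i k a ha
      have h2 : (a : ℤ) - (coverRow l i : ℤ) ≤ -(coverRow l k : ℤ) := by omega
      rw [ha]
      exact WithBot.coe_le_coe.2 h2
  · have := Finset.le_sup (f := fun i => (M i (π k)).map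
      (fun a : ℕ => (a : ℤ) - (coverRow l i : ℤ))) (Finset.mem_univ k)
    refine le_trans ?_ this
    simp only [hπ]
    refine WithBot.coe_le_coe.2 ?_
    simp

theorem exists_perm_of_range_eq {s n : ℕ} {σ : Fin s → Fin n} (hσ : Function.Injective σ) :
    ∃ (Y : Finset (Fin n)) (hY : Y.card = s) (π : Equiv.Perm (Fin s)),
      ∀ i, Y.orderEmbOfFin hY (π i) = σ i := by
  classical
  have hY : (Finset.univ.image σ).card = s := by
    rw [Finset.card_image_of_injective _ hσ, Finset.card_univ, Fintype.card_fin]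
  have h : ∀ i, ∃ k, (Finset.univ.image σ).orderEmbOfFin hY k = σ i := fun i => by
    have : σ i ∈ Set.range ((Finset.univ.image σ).orderEmbOfFin hY) := by
      rw [Finset.range_orderEmbOfFin]
      simp
    exact this
  choose f hf using h
  have hinj : Function.Injective f := fun i j hij => hσ (by rw [← hf, ← hf, hij])
  exact ⟨_, hY, Equiv.ofBijective f (Finite.injective_iff_bijective.1 hinj), hf⟩

theorem Matrix.det_submatrix_comp_perm_ne_zero_iff {m κ : Type*} [Fintype m] [DecidableEq m]
    (J : Matrix m κ ℝ) (e : m → κ) (π : Equiv.Perm m) :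
    (J.submatrix id (e ∘ π)).det ≠ 0 ↔ (J.submatrix id e).det ≠ 0 := by
  have h : J.submatrix id (e ∘ π) = (J.submatrix id e).submatrix id π := rfl
  rw [h, Matrix.det_permute']
  simp

theorem exists_zeros_isPotential_of_saddleJacobiNumber_eq_zero {s n : ℕ}
    {A : Matrix (Fin s) (Fin n) (WithBot ℕ)} (h : saddleJacobiNumber A = 0) :
    ∃ σ : Fin s → Fin n, Function.Injective σ ∧ (∀ i, A i (σ i) = 0) ∧
      ∃ α, IsPotential A σ α := by
  unfold saddleJacobiNumber at h
  simp only at h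
  split_ifs at h with hne
  swap
  · simp at h
  obtain ⟨Y, hYmem, hY⟩ := Finset.exists_mem_eq_inf' hne
    (fun Y => jacobiNumber (A.submatrix id (Subtype.val : Y → Fin n)))
  rw [h] at hY
  have hcard : Y.card = s := (Finset.mem_powersetCard.1 (Finset.mem_filter.1 hYmem).1).2
  have hJ : jacobiNumber (colBlock A Y hcard) = 0 := by
    rw [hY, ← jacobiNumber_submatrix_equiv _ (Y.orderIsoOfFin hcard).toEquiv]
    rfl
  obtain ⟨τ, hτ⟩ := exists_zeros_of_jacobiNumber_eq_zero hJ
  let π : Equiv.Perm (Fin s) := Equiv.ofBijective τ (Finite.injective_iff_bijective.1 τ.injective)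
  obtain ⟨α, hα⟩ := exists_isPotential (π := π) hJ hτ
  exact ⟨Y.orderEmbOfFin hcard ∘ τ, (Y.orderEmbOfFin hcard).injective.comp τ.injective, hτ, α, hα⟩

namespace DiffSystem

variable {s n : ℕ} (S : DiffSystem s n) {η : Jet n}

theorem jacobian_eq_zero (hη : η ∈ S.domain) {i : Fin s} {j : Fin n}
    (h : S.orderMatrix i j = ⊥) : S.jacobian η i j = 0 := by
  simp only [orderMatrix, Matrix.of_apply, jetOrder] at h
  split_ifs at h with hex
  · exact absurd h (WithBot.coe_ne_bot)
  · push Not at hex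
    exact hex 0 η hη

/-- When the Jacobi number is `0`, the truncated determinant is the Jacobian determinant with
respect to the variables themselves. -/
theorem truncatedDet_ne_zero_iff (hη : η ∈ S.domain) {Y : Finset (Fin n)} (hY : Y.card = s)
    {l : Fin s → ℕ} {π : Equiv.Perm (Fin s)}
    (hα : IsPotential (colBlock S.orderMatrix Y hY) π (coverRow l))
    (hπ : ∀ i, colBlock S.orderMatrix Y hY i (π i) = 0) :
    S.truncatedDet η Y hY l ≠ 0 ↔
      ((S.jacobian η).submatrix id (Y.orderEmbOfFin hY ∘ π)).det ≠ 0 := by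
  have h0 := Matrix.det_submatrix_comp_perm_ne_zero_iff (Matrix.of fun i k : Fin s =>
    S.partialAt η i (Y.orderEmbOfFin hY k)
      (((coverRow l i : ℤ) : WithBot ℤ) + coverCol (colBlock S.orderMatrix Y hY) l k)) id π
  rw [Matrix.submatrix_id_id] at h0
  unfold truncatedDet
  rw [← h0]
  have hentry : ∀ i k, ((coverRow l i : ℤ) : WithBot ℤ) +
      coverCol (colBlock S.orderMatrix Y hY) l (π k) =
        (((coverRow l i : ℤ) - (coverRow l k : ℤ) : ℤ) : WithBot ℤ) := fun i k => by
    rw [coverCol_eq_of_isPotential hα hπ, ← WithBot.coe_add, sub_eq_add_neg]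
  -- The derivatives have order `α i - α k`: negative orders contribute zero above the blocks, and
  -- order zero gives the Jacobian entries inside them. The entries below the blocks may differ.
  rw [Matrix.BlockTriangular.det_congr (b := OrderDual.toDual ∘ coverRow l)
    (N := (S.jacobian η).submatrix id (Y.orderEmbOfFin hY ∘ π))]
  · intro i k hik
    have hik' : coverRow l i < coverRow l k := hik
    have hneg : ¬ (0 : WithBot ℤ) ≤ (((coverRow l i : ℤ) - (coverRow l k : ℤ) : ℤ) : WithBot ℤ) := by
      intro h
      have : (0 : ℤ) ≤ (coverRow l i : ℤ) - (coverRow l k : ℤ) := WithBot.coe_le_coe.1 h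
      omega
    simp only [Matrix.submatrix_apply, Matrix.of_apply, id, Function.comp, hentry, partialAt,
      if_neg hneg]
  · intro i k hik
    have hik' : coverRow l i < coverRow l k := hik
    refine S.jacobian_eq_zero hη ?_
    by_contra hne
    obtain ⟨a, ha⟩ := WithBot.exists_natCast_of_ne_bot hne
    have := isPotential_iff.1 hα i k a ha
    omega
  · intro i k hik
    have hik' : coverRow l i = coverRow l k := hik
    simp only [Matrix.submatrix_apply, Matrix.of_apply, id, Function.comp, hentry, partialAt, hik',
      sub_self, jacobian]
    simp

/-- The potential on the right need not come from the minimal canon: nonvanishing of the truncated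
determinant reduces to that of a Jacobian minor in which the canon no longer occurs. -/
theorem isORegularAt_iff (hη : η ∈ S.domain) (hS : S.IsOSystem) :
    S.IsORegularAt η ↔ ∃ (σ : Fin s → Fin n) (α : Fin s → ℕ), Function.Injective σ ∧
      (∀ i, S.orderMatrix i (σ i) = 0) ∧ IsPotential S.orderMatrix σ α ∧
        ((S.jacobian η).submatrix id σ).det ≠ 0 := by
  constructor
  · rintro ⟨-, Y, hY, hsad, l, hl, hdet⟩
    have hJ : jacobiNumber (colBlock S.orderMatrix Y hY) = 0 := hsad.symm.trans hS
    obtain ⟨τ, hτ⟩ := exists_zeros_of_jacobiNumber_eq_zero hJ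
    let π : Equiv.Perm (Fin s) :=
      Equiv.ofBijective τ (Finite.injective_iff_bijective.1 τ.injective)
    have hα := IsCanon.isPotential_coverRow hJ hl.1 (π := π) hτ
    exact ⟨Y.orderEmbOfFin hY ∘ π, coverRow l,
      (Y.orderEmbOfFin hY).injective.comp π.injective, hτ, hα,
      (S.truncatedDet_ne_zero_iff hη hY hα hτ).1 hdet⟩
  · rintro ⟨σ, α, hσ, h0, hα, hdet⟩
    obtain ⟨Y, hY, π, hπ⟩ := exists_perm_of_range_eq hσ
    have hσπ : σ = Y.orderEmbOfFin hY ∘ π := funext fun i => (hπ i).symm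
    subst hσπ
    have hα' : IsPotential (colBlock S.orderMatrix Y hY) π α := hα
    have h0' : ∀ i, colBlock S.orderMatrix Y hY i (π i) = 0 := h0
    have hJ := jacobiNumber_eq_zero_of_isPotential hα' h0'
    obtain ⟨l, hl⟩ := exists_isMinimalCanon hα' h0'
    refine ⟨hS, Y, hY, ?_, l, hl, ?_⟩
    · rw [hJ]
      exact hS
    · exact (S.truncatedDet_ne_zero_iff hη hY (IsCanon.isPotential_coverRow hJ hl.1 h0') h0').2 hdet

end DiffSystem

/-! ### The decomposition algorithm and potentials -/

section Blocks

variable {s n : ℕ} {A : Matrix (Fin s) (Fin n) (WithBot ℕ)} {J : Matrix (Fin s) (Fin n) ℝ}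

theorem mem_zeroCols {R : Finset (Fin s)} {j : Fin n} :
    j ∈ zeroCols A R ↔ (∀ i ∈ R, A i j = 0 ∨ A i j = ⊥) ∧ ∃ i ∈ R, A i j ≠ ⊥ := by
  simp [zeroCols]

/-- The rows of `R` at which `α` is maximal. -/
def topRows (α : Fin s → ℕ) (R : Finset (Fin s)) : Finset (Fin s) :=
  R.filter (fun i => ∀ k ∈ R, α k ≤ α i)

theorem topRows_nonempty (α : Fin s → ℕ) {R : Finset (Fin s)} (hR : R.Nonempty) :
    (topRows α R).Nonempty := by
  obtain ⟨i, hi, h⟩ := Finset.exists_max_image R α hR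
  exact ⟨i, Finset.mem_filter.2 ⟨hi, h⟩⟩

open Classical in
/-- The columns `σ k`, `α k = a`, that are not entirely `-∞` in the rows `R`. -/
noncomputable def topCols (A : Matrix (Fin s) (Fin n) (WithBot ℕ)) (σ : Fin s → Fin n)
    (α : Fin s → ℕ) (R : Finset (Fin s)) (a : ℕ) : Finset (Fin n) :=
  (Finset.univ.filter (fun k => α k = a)).image σ |>.filter (fun j => ∃ i ∈ R, A i j ≠ ⊥)

/-- A finite entry `a` gives `a + α t ≤ α i ≤ α t`, so both inequalities are equalities. -/
theorem IsPotential.eq_zero_and_mem_topRows {σ : Fin s → Fin n} {α : Fin s → ℕ}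
    (hα : IsPotential A σ α) {R : Finset (Fin s)} {t : Fin s} (ht : t ∈ topRows α R)
    {i k : Fin s} (hi : i ∈ R) (hk : α k = α t) (h : A i (σ k) ≠ ⊥) :
    A i (σ k) = 0 ∧ i ∈ topRows α R := by
  obtain ⟨a, ha⟩ := WithBot.exists_natCast_of_ne_bot h
  have h1 := isPotential_iff.1 hα i k a ha
  have ht' := (Finset.mem_filter.1 ht).2
  have h2 := ht' i hi
  have h3 : a = 0 := by omega
  refine ⟨by rw [ha, h3]; rfl, Finset.mem_filter.2 ⟨hi, fun k' hk' => ?_⟩⟩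
  have := ht' k' hk'
  omega

/-- Within `R`, the zeros of the top columns lie in the top rows, which `σ` matches into these
columns; `konig_of_matched` applies. -/
theorem topRows_subset_konigRows_and_disjoint {σ : Fin s → Fin n} {α : Fin s → ℕ}
    (hσ : Function.Injective σ) (h0 : ∀ i, A i (σ i) = 0) (hα : IsPotential A σ α)
    {R : Finset (Fin s)} {t : Fin s} (ht : t ∈ topRows α R) :
    topRows α R ⊆ konigRows A R (zeroCols A R) ∧
      topCols A σ α R (α t) ⊆ zeroCols A R \ konigCols A R (zeroCols A R) := by
  classical
  have hW : ∀ j ∈ topCols A σ α R (α t), (∃ k, α k = α t ∧ σ k = j) ∧ ∃ i ∈ R, A i j ≠ ⊥ := by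
    intro j hj
    simpa [topCols] using hj
  have hsub : topCols A σ α R (α t) ⊆ zeroCols A R := by
    intro j hj
    obtain ⟨⟨k, hk, rfl⟩, hex⟩ := hW j hj
    refine mem_zeroCols.2 ⟨fun i hi => ?_, hex⟩
    by_cases hb : A i (σ k) = ⊥
    · exact Or.inr hb
    · exact Or.inl (hα.eq_zero_and_mem_topRows ht hi hk hb).1
  have htop : ∀ i ∈ topRows α R, α i = α t := fun i hi =>
    le_antisymm ((Finset.mem_filter.1 ht).2 i (Finset.mem_filter.1 hi).1)
      ((Finset.mem_filter.1 hi).2 t (Finset.mem_filter.1 ht).1)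
  obtain ⟨h1, h2⟩ := konig_of_matched (A := A) (R := R) (C := zeroCols A R) (T := topRows α R)
    (W := topCols A σ α R (α t)) (Finset.filter_subset _ _) (by
      intro i hi j hj hij
      obtain ⟨⟨k, hk, rfl⟩, -⟩ := hW j hj
      exact (hα.eq_zero_and_mem_topRows ht hi hk (by simp [hij])).2) hsub σ hσ.injOn
    (by
      intro i hi
      simp only [topCols, Finset.mem_filter, Finset.mem_image, Finset.mem_univ, true_and]
      exact ⟨⟨i, htop i hi, rfl⟩, i, (Finset.mem_filter.1 hi).1, by simp [h0]⟩)
    (fun i _ => h0 i)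
  exact ⟨h1, fun j hj => Finset.mem_sdiff.2 ⟨hsub hj, Finset.disjoint_left.1 h2 hj⟩⟩

theorem topRows_subset_konigRows {σ : Fin s → Fin n} {α : Fin s → ℕ}
    (hσ : Function.Injective σ) (h0 : ∀ i, A i (σ i) = 0) (hα : IsPotential A σ α)
    (R : Finset (Fin s)) : topRows α R ⊆ konigRows A R (zeroCols A R) := fun _ ht =>
  (topRows_subset_konigRows_and_disjoint hσ h0 hα ht).1 ht

/-- A linear relation between the rows of `R₀` does not involve the rows of maximal potential. -/
theorem eq_zero_of_mem_topRows (hJ : ∀ i j, A i j = ⊥ → J i j = 0) {σ : Fin s → Fin n}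
    {α : Fin s → ℕ} (hσ : Function.Injective σ) (h0 : ∀ i, A i (σ i) = 0)
    (hα : IsPotential A σ α) (hdet : (J.submatrix id σ).det ≠ 0) {R : Finset (Fin s)}
    {c : Fin s → ℝ} (hc : ∀ j ∈ zeroCols A R \ konigCols A R (zeroCols A R),
      ∑ i ∈ konigRows A R (zeroCols A R), c i * J i j = 0) {t : Fin s} (ht : t ∈ topRows α R) :
    c t = 0 := by
  classical
  obtain ⟨h1, h2⟩ := topRows_subset_konigRows_and_disjoint hσ h0 hα ht
  have hzero : ∀ i k, α i < α k → J.submatrix id σ i k = 0 := by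
    intro i k hik
    refine hJ _ _ ?_
    by_contra hne
    obtain ⟨a, ha⟩ := WithBot.exists_natCast_of_ne_bot hne
    have := isPotential_iff.1 hα i k a ha
    omega
  have htop : ∀ i ∈ topRows α R, α i = α t := fun i hi =>
    le_antisymm ((Finset.mem_filter.1 ht).2 i (Finset.mem_filter.1 hi).1)
      ((Finset.mem_filter.1 hi).2 t (Finset.mem_filter.1 ht).1)
  -- Rows outside `R` may have the same potential as `t`, so the coefficients are cut off to
  -- `topRows α R`.
  have key := Matrix.eq_zero_of_blockTriangular_of_det_ne_zero hzero hdet (α t)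
    (fun i => if i ∈ topRows α R then c i else 0) (by
      intro k hk
      have hsum : ∑ i with α i = α t,
          (if i ∈ topRows α R then c i else 0) * J.submatrix id σ i k =
            ∑ i ∈ topRows α R, c i * J i (σ k) := by
        symm
        refine Finset.sum_subset_zero_on_sdiff
          (fun i hi => Finset.mem_filter.2 ⟨Finset.mem_univ _, htop i hi⟩) ?_ ?_
        · intro i hi
          rw [if_neg (Finset.mem_sdiff.1 hi).2, zero_mul]
        · intro i hi
          rw [if_pos hi]
          rfl
      rw [hsum]
      -- A column entirely `-∞` on `R` is not in `zeroCols`, so `hc` says nothing about it, but its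
      -- Jacobian entries vanish there.
      by_cases hex : ∃ i ∈ R, A i (σ k) ≠ ⊥
      · have hW : σ k ∈ topCols A σ α R (α t) := by
          simp only [topCols, Finset.mem_filter, Finset.mem_image, Finset.mem_univ, true_and]
          exact ⟨⟨k, hk, rfl⟩, hex⟩
        rw [← hc _ (h2 hW)]
        refine Finset.sum_subset h1 fun i hi hiT => ?_
        rw [hJ i (σ k), mul_zero]
        by_contra hne
        exact hiT (hα.eq_zero_and_mem_topRows ht (konigRows_subset hi) hk hne).2
      · push Not at hex
        refine Finset.sum_eq_zero fun i hi => ?_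
        rw [hJ i (σ k) (hex i (Finset.mem_filter.1 hi).1), mul_zero])
    t rfl
  simpa [ht] using key

/-! ### Termination and the steps of the algorithm -/

theorem remainingRows_succ (k : ℕ) : remainingRows A (k + 1) = remainingRows A k \
    konigRows A (remainingRows A k) (zeroCols A (remainingRows A k)) := rfl

theorem remainingRows_antitone : Antitone (remainingRows A) :=
  antitone_nat_of_succ_le fun _ => Finset.sdiff_subset

/-- Every step removes at least the rows of maximal potential, so the algorithm stops after at most
`s` steps. -/
theorem remainingRows_numBlocks {σ : Fin s → Fin n} {α : Fin s → ℕ}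
    (hσ : Function.Injective σ) (h0 : ∀ i, A i (σ i) = 0) (hα : IsPotential A σ α) :
    remainingRows A (numBlocks A) = ∅ := by
  have hcard : ∀ k, (remainingRows A k).card ≤ s - k := by
    intro k
    induction k with
    | zero => simpa using Finset.card_le_univ (remainingRows A 0)
    | succ k ih =>
      rcases (remainingRows A k).eq_empty_or_nonempty with he | hne
      · have := remainingRows_antitone (A := A) (Nat.le_succ k)
        rw [he, Finset.subset_empty] at this
        simp [this]
      · obtain ⟨t, ht⟩ := topRows_nonempty α hne
        have hlt : (remainingRows A (k + 1)).card < (remainingRows A k).card := by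
          refine Finset.card_lt_card ⟨Finset.sdiff_subset, fun h => ?_⟩
          exact (Finset.mem_sdiff.1 (h (Finset.mem_filter.1 ht).1)).2
            (topRows_subset_konigRows hσ h0 hα _ ht)
        omega
  exact Nat.sInf_mem (s := {k : ℕ | remainingRows A k = ∅})
    ⟨s, Finset.card_eq_zero.1 (by simpa using hcard s)⟩

/-- Every row is removed at exactly one step. -/
theorem exists_step (h : remainingRows A (numBlocks A) = ∅) :
    ∃ st : Fin s → ℕ, (∀ i, st i < numBlocks A) ∧ ∀ i k, i ∈ remainingRows A k ↔ k ≤ st i := by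
  classical
  have key : ∀ i : Fin s, ∃ m, m < numBlocks A ∧ ∀ k, i ∈ remainingRows A k ↔ k ≤ m := by
    intro i
    have hex : ∃ k, i ∉ remainingRows A k := ⟨numBlocks A, by simp [h]⟩
    have hpos : Nat.find hex ≠ 0 := fun h0 => by
      have := Nat.find_spec hex
      rw [h0] at this
      exact this (Finset.mem_univ i)
    have hle : Nat.find hex ≤ numBlocks A := Nat.find_min' hex (by simp [h])
    refine ⟨Nat.find hex - 1, by omega, fun k => ⟨fun hk => ?_, fun hk => ?_⟩⟩
    · by_contra hlt
      exact Nat.find_spec hex (remainingRows_antitone (by omega : Nat.find hex ≤ k) hk)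
    · by_contra hk'
      have := Nat.find_min' hex hk'
      omega
  choose st hst using key
  exact ⟨st, fun i => (hst i).1, fun i => (hst i).2⟩

theorem mem_konigRows_remainingRows_iff {st : Fin s → ℕ}
    (hst : ∀ i k, i ∈ remainingRows A k ↔ k ≤ st i) {i : Fin s} {k : ℕ} :
    i ∈ konigRows A (remainingRows A k) (zeroCols A (remainingRows A k)) ↔ st i = k := by
  constructor
  · intro hi
    have h1 := (hst i k).1 (konigRows_subset hi)
    have h2 : ¬ k + 1 ≤ st i := fun h => (Finset.mem_sdiff.1 ((hst i (k + 1)).2 h)).2 hi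
    omega
  · rintro rfl
    have h1 := (hst i (st i)).2 le_rfl
    by_contra hi
    have := (hst i (st i + 1)).1 (Finset.mem_sdiff.2 ⟨h1, hi⟩)
    omega

/-- The columns attached to step `k` are `-∞` in the rows removed later, and `0` or `-∞` in the
rows removed at step `k`. -/
theorem step_eq_of_mem_cols {st : Fin s → ℕ} (hst : ∀ i k, i ∈ remainingRows A k ↔ k ≤ st i)
    {i : Fin s} {j : Fin n} {k : ℕ}
    (hj : j ∈ zeroCols A (remainingRows A k) \
      konigCols A (remainingRows A k) (zeroCols A (remainingRows A k)))
    (hk : k ≤ st i) (hij : A i j ≠ ⊥) : A i j = 0 ∧ st i = k := by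
  obtain ⟨h1, h2⟩ := Finset.mem_sdiff.1 hj
  have hi := (hst i k).2 hk
  have h3 := ((mem_zeroCols.1 h1).1 i hi).resolve_right hij
  exact ⟨h3, (mem_konigRows_remainingRows_iff hst).1 (mem_konigRows_of_eq_zero hi h1 h2 h3)⟩

/-- A column of the later step has a finite entry in a row still present then, which a column of an
earlier step cannot have. -/
theorem step_unique_of_mem_cols {st : Fin s → ℕ} (hst : ∀ i k, i ∈ remainingRows A k ↔ k ≤ st i)
    {j : Fin n} {k k' : ℕ}
    (hj : j ∈ zeroCols A (remainingRows A k) \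
      konigCols A (remainingRows A k) (zeroCols A (remainingRows A k)))
    (hj' : j ∈ zeroCols A (remainingRows A k') \
      konigCols A (remainingRows A k') (zeroCols A (remainingRows A k'))) : k = k' := by
  wlog hkk : k ≤ k' generalizing k k'
  · exact (this hj' hj (le_of_not_ge hkk)).symm
  obtain ⟨i, hi, hij⟩ := (mem_zeroCols.1 (Finset.mem_sdiff.1 hj').1).2
  have h1 := (hst i k').1 hi
  have h2 := (step_eq_of_mem_cols hst hj (hkk.trans h1) hij).2
  omega

/-- If the Jacobian matrices of all the blocks have full rank, then some columns, one set for each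
block, give a nonzero minor and a vanishing Jacobi number. -/
theorem exists_isPotential_of_rank_blocks (hJ : ∀ i j, A i j = ⊥ → J i j = 0)
    (hrem : remainingRows A (numBlocks A) = ∅)
    (hrank : ∀ h ∈ Finset.Icc 1 (numBlocks A),
      (subBlock J (blockRows A h) (blockCols A h)).rank = (blockRows A h).card) :
    ∃ (σ : Fin s → Fin n) (α : Fin s → ℕ), Function.Injective σ ∧
      (∀ i, A i (σ i) = 0) ∧ IsPotential A σ α ∧ (J.submatrix id σ).det ≠ 0 := by
  classical
  obtain ⟨st, hlt, hst⟩ := exists_step hrem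
  let X : ℕ → Finset (Fin n) := fun k => zeroCols A (remainingRows A k) \
    konigCols A (remainingRows A k) (zeroCols A (remainingRows A k))
  -- The block diagonal part of `J`; its rows are independent because the column sets `X k` are
  -- disjoint.
  let J' : Matrix (Fin s) (Fin n) ℝ := Matrix.of fun i j => if j ∈ X (st i) then J i j else 0
  obtain ⟨σ₀, hσ₀, hdet₀⟩ := exists_injective_det_submatrix_ne_zero J' (by
    intro c hc
    ext i
    have hi := hlt i
    have hr := hrank (numBlocks A - st i) (Finset.mem_Icc.2 ⟨by omega, by omega⟩)
    rw [blockRows, blockCols, Nat.sub_sub_self hi.le, rank_subBlock_eq_card_iff] at hr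
    refine hr c (fun j hj => ?_) i ((mem_konigRows_remainingRows_iff hst).2 rfl)
    rw [← hc j]
    refine Finset.sum_subset_zero_on_sdiff (Finset.subset_univ _) ?_ ?_
    · intro i' hi'
      have hne : st i' ≠ st i := fun h =>
        (Finset.mem_sdiff.1 hi').2 ((mem_konigRows_remainingRows_iff hst).2 h)
      have : j ∉ X (st i') := fun h => hne (step_unique_of_mem_cols hst h hj)
      simp [J', this]
    · intro i' hi'
      have h1 : st i' = st i := (mem_konigRows_remainingRows_iff hst).1 hi'
      have h2 : j ∈ X (st i') := by rw [h1]; exact hj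
      simp [J', h2])
  -- A nonzero term of the determinant expansion reindexes the columns so that row `i` gets a column
  -- of its own block.
  have hτ : ∃ τ : Equiv.Perm (Fin s), ∀ i, J' (τ i) (σ₀ i) ≠ 0 := by
    by_contra! hne
    refine hdet₀ ?_
    rw [Matrix.det_apply]
    refine Finset.sum_eq_zero fun τ _ => ?_
    obtain ⟨i, hi⟩ := hne τ
    rw [Finset.prod_eq_zero (Finset.mem_univ i) hi, smul_zero]
  obtain ⟨τ, hτ⟩ := hτ
  let σ : Fin s → Fin n := σ₀ ∘ τ.symm
  have hdet' : (J'.submatrix id σ).det ≠ 0 :=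
    (Matrix.det_submatrix_comp_perm_ne_zero_iff J' σ₀ τ.symm).2 hdet₀
  have hne : ∀ i, J' i (σ i) ≠ 0 := fun i => by simpa [σ] using hτ (τ.symm i)
  have hX : ∀ i, σ i ∈ X (st i) := fun i => by
    by_contra h
    exact hne i (by simp [J', h])
  have hstep : ∀ i k, A i (σ k) ≠ ⊥ → st i ≤ st k := fun i k h => by
    by_contra hlt'
    have := (step_eq_of_mem_cols hst (hX k) (le_of_not_ge hlt') h).2
    omega
  have hzero : ∀ i k, A i (σ k) ≠ ⊥ → st i = st k → A i (σ k) = 0 := fun i k h hik =>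
    (step_eq_of_mem_cols hst (hX k) hik.ge h).1
  have hdiag : ∀ i, A i (σ i) = 0 := fun i => hzero i i (fun hb => hne i (by
    have := hJ i (σ i) hb
    simp [J', this])) rfl
  have hJ0 : ∀ i k, st k < st i → J i (σ k) = 0 := fun i k hik => hJ _ _ (by
    by_contra hb
    have := hstep i k hb
    omega)
  let N : ℕ := Finset.univ.sup (fun p : Fin s × Fin n => (A p.1 p.2).unbotD 0)
  -- A finite entry has `st i ≤ st k` and is zero in case of equality. So rows removed earlier get
  -- larger potentials, and a difference of one step pays for any finite entry.
  refine ⟨σ, fun i => N * (numBlocks A - st i), hσ₀.comp τ.symm.injective, hdiag, ?_, ?_⟩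
  · refine isPotential_iff.2 fun i k a ha => ?_
    have hb : A i (σ k) ≠ ⊥ := by simp [ha]
    have haN : a ≤ N := by
      have := Finset.le_sup (f := fun p : Fin s × Fin n => (A p.1 p.2).unbotD 0)
        (Finset.mem_univ (i, σ k))
      simp only [ha] at this
      exact this
    rcases (hstep i k hb).eq_or_lt with h | h
    · have h0 := hzero i k hb h
      rw [ha] at h0
      have h0' : a = 0 := by exact_mod_cast h0
      rw [h0', h, zero_add]
    · have hk := hlt k
      obtain ⟨d, hd⟩ : ∃ d, numBlocks A - st i = (numBlocks A - st k) + 1 + d :=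
        ⟨st k - st i - 1, by omega⟩
      simp only [hd]
      nlinarith [Nat.zero_le (N * d)]
  · rw [Matrix.BlockTriangular.det_congr (b := st) (N := J'.submatrix id σ)]
    · exact hdet'
    · intro i k hik
      exact hJ0 i k hik
    · intro i k hik
      simp [J', hJ0 i k hik]
    · intro i k hik
      have : σ k ∈ X (st i) := by rw [hik]; exact hX k
      simp [J', this]

end Blocks

/-! ### Dense order `1` block triangular matrices -/

section Dense

variable {s n : ℕ} {A : Matrix (Fin s) (Fin n) (WithBot ℕ)} {p : ℕ} {eqLev : Fin s → ℕ}
  {varLev : Fin n → ℕ}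

/-- The block is square with entries at most `1` and Jacobi number equal to its size, so a maximal
transversal consists of ones and meets every column. -/
theorem IsOrderOneBlockTriangular.exists_eq_one (hT : IsOrderOneBlockTriangular A p eqLev varLev)
    {j : Fin n} (hj : varLev j < p) : ∃ i, eqLev i = varLev j + 1 ∧ A i j = 1 := by
  have hmem : varLev j + 1 ∈ Finset.Icc 1 p := Finset.mem_Icc.2 ⟨by omega, by omega⟩
  have hcard := hT.card_eq _ hmem
  have hjac := hT.jacobi_prev _ hmem
  rw [Nat.add_sub_cancel] at hcard hjac
  have hnb : jacobiNumber (subBlock A (levelSet eqLev (varLev j + 1))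
      (levelSet varLev (varLev j))) ≠ ⊥ := by
    rw [hjac]
    exact WithBot.coe_ne_bot
  obtain ⟨τ, hτ⟩ := exists_eq_jacobiNumber hnb
  rw [← hτ] at hnb
  obtain ⟨a, ha⟩ := WithBot.exists_natCast_of_sum_ne_bot hnb
  rw [hjac, WithBot.sum_natCast_eq ha] at hτ
  have hsum : ∑ i, a i = (levelSet varLev (varLev j)).card := by exact_mod_cast hτ
  have hle : ∀ i, a i ≤ 1 := fun i => by
    have h1 : varLev (τ i) = varLev j := (Finset.mem_filter.1 (τ i).2).2
    have h2 : eqLev i = varLev j + 1 := (Finset.mem_filter.1 i.2).2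
    have h3 : A i (τ i) ≤ 1 := hT.order_one i (τ i) (by omega)
    have h4 : A i (τ i) = a i := ha i
    rw [h4] at h3
    exact_mod_cast h3
  have hone : ∀ i, a i = 1 := fun i =>
    (Finset.sum_eq_sum_iff_of_le (g := fun _ => 1) fun i _ => hle i).1 (by
      rw [hsum, hcard]
      simp) i (Finset.mem_univ _)
  have hbij : Function.Bijective τ :=
    (Fintype.bijective_iff_injective_and_card τ).2 ⟨τ.injective, by simp [hcard]⟩
  obtain ⟨i, hi⟩ := hbij.2 ⟨j, Finset.mem_filter.2 ⟨Finset.mem_univ _, rfl⟩⟩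
  refine ⟨i, (Finset.mem_filter.1 i.2).2, ?_⟩
  have h := ha i
  rw [hi, hone i] at h
  exact h

theorem IsOrderOneBlockTriangular.varLev_le_eqLev (hT : IsOrderOneBlockTriangular A p eqLev varLev)
    {i : Fin s} {j : Fin n} (h : A i j ≠ ⊥) : varLev j ≤ eqLev i := by
  by_contra hlt
  exact h (hT.free_above i j (by omega))

/-- In the dense case, a choice of variables with vanishing Jacobi number matches equations and
variables of the same level. -/
theorem IsOrderOneBlockTriangular.varLev_eq_eqLev (hT : IsOrderOneBlockTriangular A p eqLev varLev)
    (hd : ∀ h ∈ Finset.Icc 1 p, ∀ i ∈ levelSet eqLev h, ∀ j ∈ levelSet varLev h, A i j = 0)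
    {σ : Fin s → Fin n} {α : Fin s → ℕ} (h0 : ∀ i, A i (σ i) = 0) (hα : IsPotential A σ α)
    (i : Fin s) : varLev (σ i) = eqLev i := by
  have hle : ∀ k, varLev (σ k) ≤ eqLev k := fun k => hT.varLev_le_eqLev (by simp [h0])
  -- Among the rows of level at most `eqLev i`, take `m` of maximal potential. If `σ m` had a lower
  -- level, an entry `1` in its column would give such a row a larger potential. By density `A i (σ
  -- m) = 0`, so `i` is maximal too and the same argument applies to it.
  obtain ⟨m, hm, hmax⟩ := Finset.exists_max_image
    (Finset.univ.filter (fun k => eqLev k ≤ eqLev i)) α ⟨i, by simp⟩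
  simp only [Finset.mem_filter, Finset.mem_univ, true_and] at hm hmax
  have hlevel : ∀ k, eqLev k ≤ eqLev i → α k = α m → varLev (σ k) = eqLev i := by
    intro k hk hkm
    by_contra hne
    have h1 := hle k
    have h2 := hT.eq_le i
    obtain ⟨r, hr, hr1⟩ := hT.exists_eq_one (j := σ k) (by omega)
    have h3 := isPotential_iff.1 hα r k 1 hr1
    have h4 := hmax r (by omega)
    omega
  have hm1 := hlevel m hm rfl
  refine hlevel i le_rfl (le_antisymm (hmax i le_rfl) ?_)
  have h1 := hd (eqLev i) (Finset.mem_Icc.2 ⟨hT.eq_pos i, hT.eq_le i⟩) i (by simp [levelSet])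
    (σ m) (by simp [levelSet, hm1])
  have h2 := isPotential_iff.1 hα i m 0 h1
  omega

theorem IsOrderOneBlockTriangular.isPotential_eqLev
    (hT : IsOrderOneBlockTriangular A p eqLev varLev) {σ : Fin s → Fin n}
    (hσ : ∀ i, varLev (σ i) = eqLev i) : IsPotential A σ eqLev := by
  refine isPotential_iff.2 fun i k a ha => ?_
  have h1 := hT.varLev_le_eqLev (i := i) (j := σ k) (by simp [ha])
  rw [hσ] at h1
  by_cases h : varLev (σ k) + 1 = eqLev i
  · have h2 := hT.order_one i (σ k) h
    rw [ha] at h2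
    have h3 : a ≤ 1 := by exact_mod_cast h2
    rw [hσ] at h
    omega
  · have h2 := hT.order_zero i (σ k) h
    rw [ha] at h2
    have h3 : a ≤ 0 := by exact_mod_cast h2
    omega

/-- A row of lower level has its zeros in columns of lower level, and such a column contains a `1`
in a remaining row, so it is excluded from `zeroCols`. -/
theorem IsOrderOneBlockTriangular.konigRows_subset_topRows
    (hT : IsOrderOneBlockTriangular A p eqLev varLev) {R : Finset (Fin s)} {g : ℕ}
    (hR : ∀ i, i ∈ R ↔ eqLev i ≤ g) :
    konigRows A R (zeroCols A R) ⊆ topRows eqLev R := by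
  intro i hi
  refine Finset.mem_filter.2 ⟨konigRows_subset hi, fun k hk => ?_⟩
  by_contra hlt
  obtain ⟨j, hj, hij⟩ := exists_eq_zero_of_mem_konigRows hi
  have h1 := hT.varLev_le_eqLev (i := i) (j := j) (by simp [hij])
  have h2 := hT.eq_le k
  have h3 := (hR k).1 hk
  obtain ⟨r, hr, hr1⟩ := hT.exists_eq_one (j := j) (by omega)
  rcases (mem_zeroCols.1 hj).1 r ((hR r).2 (by omega)) with h | h <;> simp [hr1] at h

/-- Each step removes exactly the highest remaining level. -/
theorem IsOrderOneBlockTriangular.exists_mem_remainingRows_iff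
    (hT : IsOrderOneBlockTriangular A p eqLev varLev) {σ : Fin s → Fin n}
    (hσ : Function.Injective σ) (h0 : ∀ i, A i (σ i) = 0) (hα : IsPotential A σ eqLev) (k : ℕ) :
    ∃ g, ∀ i, i ∈ remainingRows A k ↔ eqLev i ≤ g := by
  induction k with
  | zero => exact ⟨p, fun i => ⟨fun _ => hT.eq_le i, fun _ => Finset.mem_univ i⟩⟩
  | succ k ih =>
    obtain ⟨g, hg⟩ := ih
    have htop := (hT.konigRows_subset_topRows hg).antisymm (topRows_subset_konigRows hσ h0 hα _)
    rcases (remainingRows A k).eq_empty_or_nonempty with he | hne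
    · refine ⟨g, fun i => ?_⟩
      rw [← hg i, remainingRows_succ, he]
      simp
    · obtain ⟨t, ht⟩ := topRows_nonempty eqLev hne
      obtain ⟨htR, hmax⟩ := Finset.mem_filter.1 ht
      have hpos := hT.eq_pos t
      refine ⟨eqLev t - 1, fun i => ?_⟩
      rw [remainingRows_succ, htop, Finset.mem_sdiff]
      constructor
      · rintro ⟨hi, hit⟩
        have h1 := hmax i hi
        by_contra hlt
        refine hit (Finset.mem_filter.2 ⟨hi, fun k' hk' => ?_⟩)
        have := hmax k' hk'
        omega
      · intro hi
        have h1 := (hg t).1 htR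
        refine ⟨(hg i).2 (by omega), fun hit => ?_⟩
        have := (Finset.mem_filter.1 hit).2 t htR
        omega

end Dense

/-! ### The rank criterion -/

theorem mainTheorem9 {s n : ℕ} (S : DiffSystem s n) (η : Jet n) (hη : η ∈ S.domain)
    (hS : S.IsOSystem)
    (hab : IsDenseOrderOneBlockTriangular S.orderMatrix ∨
      ∀ h ∈ Finset.Icc 1 (numBlocks S.orderMatrix),
        ∀ R' ⊆ blockRows S.orderMatrix h, R'.card + 1 = (blockRows S.orderMatrix h).card →
          (subBlock (S.jacobian η) R' (blockCols S.orderMatrix h)).rank = R'.card) :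
    S.IsORegularAt η ↔
      ∀ h ∈ Finset.Icc 1 (numBlocks S.orderMatrix),
        (subBlock (S.jacobian η) (blockRows S.orderMatrix h) (blockCols S.orderMatrix h)).rank =
          (blockRows S.orderMatrix h).card := by
  classical
  have hJ : ∀ i j, S.orderMatrix i j = ⊥ → S.jacobian η i j = 0 :=
    fun _ _ h => S.jacobian_eq_zero hη h
  rw [S.isORegularAt_iff hη hS]
  constructor
  · rintro ⟨σ, α, hσ, h0, hα, hdet⟩ h hh
    rw [rank_subBlock_eq_card_iff]
    intro c hc i hi
    rcases hab with ⟨p, eqLev, varLev, hT, hd⟩ | hb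
    -- The given potential serves only to show that `σ` respects levels; it is then replaced by
    -- `eqLev`, for which every row of `R₀` is a top row.
    · have hα' := hT.isPotential_eqLev (hT.varLev_eq_eqLev hd h0 hα)
      obtain ⟨g, hg⟩ := hT.exists_mem_remainingRows_iff hσ h0 hα'
        (numBlocks S.orderMatrix - h)
      exact eq_zero_of_mem_topRows hJ hσ h0 hα' hdet hc (hT.konigRows_subset_topRows hg hi)
    · obtain ⟨t, ht⟩ := topRows_nonempty α ⟨i, konigRows_subset hi⟩
      have hct := eq_zero_of_mem_topRows hJ hσ h0 hα hdet hc ht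
      have htB : t ∈ blockRows S.orderMatrix h := topRows_subset_konigRows hσ h0 hα _ ht
      have hrank := hb h hh _ (Finset.erase_subset t _) (Finset.card_erase_add_one htB)
      rw [rank_subBlock_eq_card_iff] at hrank
      by_cases hit : i = t
      · rw [hit, hct]
      · refine hrank c (fun j hj => ?_) i (Finset.mem_erase.2 ⟨hit, hi⟩)
        rw [Finset.sum_erase _ (by rw [hct, zero_mul])]
        exact hc j hj
  · intro hrank
    -- This transversal only guarantees termination; the regular one is built from the ranks.
    obtain ⟨σ, hσ, h0, α, hα⟩ := exists_zeros_isPotential_of_saddleJacobiNumber_eq_zero hS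
    exact exists_isPotential_of_rank_blocks hJ (remainingRows_numBlocks hσ h0 hα) hrank
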